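/- Theorem. Let $\alpha\in(0,\tfrac12)$ be irrational with continued fraction expansion $\alpha=[0;a_1,a_2,\dots]$ (so $a_1\ge 2$). A Sturmian word of slope $\alpha$ is an infinite word over $\{0,1\}$ that codes the orbit of some point $x\in[0,1)$ under the rotation $R(y)=\{y+\alpha\}$ of the circle $[0,1)$: its $n$-th letter ($n\ge 0$) is $0$ if $R^n(x)\in I_0$ and $1$ if $R^n(x)\in I_1$, where either $I_0=[0,1-\alpha)$ and $I_1=[1-\alpha,1)$, or $I_0=(0,1-\alpha]$ and $I_1=(1-\alpha,1]$ (the point $1$ being identified with $0$). The standard words of slope $\alpha$ are the words $s_k$, $k\ge 0$, given by $$s_{-1}=1,\qquad s_0=0,\qquad s_1=s_0^{a_1-1}s_{-1},\qquad s_k=s_{k-1}^{a_k}s_{k-2}\quad(k\ge 2);$$ the semistandard words of slope $\alpha$ are the words $s_{k,\ell}=s_{k-1}^{\ell}s_{k-2}$ with $k\ge 2$ and $1\le \ell<a_k$; and $c_\alpha=\lim_{k\to\infty}s_k$. Let $\mathrm{RSSt}(\alpha)$ be the set of reversals of the standard and semistandard words of slope $\alpha$. Let $s$ be a Sturmian word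 of slope $\alpha$. Then $s$ can be written as an infinite product $s=X_1^2X_2^2X_3^2\cdots$ with all $X_i\in\mathrm{RSSt}(\alpha)$ if and only if $s$ is not of the form $X_1^2X_2^2\cdots X_n^2\,c$ with $n\ge 0$, $X_1,\dots,X_n\in\mathrm{RSSt}(\alpha)$ and $c\in\{01c_\alpha,10c_\alpha\}$. Moreover, if $s$ is such an infinite product, then the sequence $(X_i)_{i\ge 1}$ is unique. -/

import Mathlib

noncomputable section

namespace SturmianSquares

/-- Finite words over the alphabet `{0, 1}`. -/
abbrev Word := List (Fin 2)

/-- Infinite words over the alphabet `{0, 1}`, that is, functions from `ℕ` to the alphabet. -/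
abbrev InfWord := Stream' (Fin 2)

/-! ### Sturmian words of slope `α` as codings of irrational rotations -/

open Classical in
/-- Coding of the orbit of `x` under the rotation `R(y) = {y + α}` with respect to the partition
`I₀ = [0, 1 - α)`, `I₁ = [1 - α, 1)`. Its `n`-th letter is `ν(Rⁿ(x))`, and `Rⁿ(x) = {x + nα}`. -/
def lowerCoding (α x : ℝ) : InfWord :=
  fun n => if Int.fract (x + n * α) ∈ Set.Ico 0 (1 - α) then 0 else 1

open Classical in
/-- Coding of the orbit of `x` under the rotation `R(y) = {y + α}` with respect to the partition
`I₀ = (0, 1 - α]`, `I₁ = (1 - α, 1]`, the point `1` being identified with `0`. -/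
def upperCoding (α x : ℝ) : InfWord :=
  fun n => if Int.fract (x + n * α) ∈ Set.Ioc 0 (1 - α) then 0 else 1

/-- The Sturmian words of slope `α` (used for irrational `α ∈ (0, 1)`). -/
def IsSturmian (α : ℝ) (s : InfWord) : Prop :=
  ∃ x ∈ Set.Ico (0 : ℝ) 1, s = lowerCoding α x ∨ s = upperCoding α x

/-! ### Standard and semistandard words -/

/-- The partial quotient `aₖ` of the continued fraction expansion `α = [a₀; a₁, a₂, …]`, as a
natural number (used for irrational `α ∈ (0, 1)`, where every `aₖ` exists and is nonnegative). -/
def partialQuotient (α : ℝ) (k : ℕ) : ℕ :=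
  match GenContFract.IntFractPair.stream α k with
  | some p => p.b.toNat
  | none => 0

/-- The power `wⁿ` of a finite word. -/
def wordPow (w : Word) (n : ℕ) : Word := (List.replicate n w).flatten

/-- The standard words `sₖ`, `k ≥ 0`, of slope `α`: with `s₋₁ = 1`,
`s₀ = 0`, `s₁ = s₀ ^ (a₁ - 1) s₋₁`, and `sₖ = sₖ₋₁ ^ aₖ sₖ₋₂` for `k ≥ 2`. -/
def standardWord (α : ℝ) : ℕ → Word
  | 0 => [0]
  | 1 => wordPow [0] (partialQuotient α 1 - 1) ++ [1]
  | k + 2 => wordPow (standardWord α (k + 1)) (partialQuotient α (k + 2)) ++ standardWord α k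

/-- `semistandardWord α k ℓ` is the word `s_{k+2,ℓ} = s_{k+1} ^ ℓ s_k`; it is a semistandard word
when `1 ≤ ℓ < a_{k+2}`. -/
def semistandardWord (α : ℝ) (k ℓ : ℕ) : Word :=
  wordPow (standardWord α (k + 1)) ℓ ++ standardWord α k

/-- The set of standard and semistandard words of slope `α`. -/
def standardOrSemistandard (α : ℝ) : Set Word :=
  {w | (∃ k, w = standardWord α k) ∨
    ∃ k ℓ, 1 ≤ ℓ ∧ ℓ < partialQuotient α (k + 2) ∧ w = semistandardWord α k ℓ}

/-- The set of reversed standard and reversed semistandard words of slope `α`. -/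
def RSSt (α : ℝ) : Set Word := List.reverse '' standardOrSemistandard α

/-- The infinite standard Sturmian word `c_α = lim sₖ`. For `k ≥ 1` the word `sₖ` is a prefix of
`sₖ₊₁`, and `sₙ₊₁` has more than `n` letters, so that the `n`-th letter of the limit is the `n`-th
letter of `sₙ₊₁` (the default value in `getD` is never used). -/
def standardInfWord (α : ℝ) : InfWord := fun n => (standardWord α (n + 1)).getD n 0

/-! ### Products of squares -/

/-- The finite product of squares `X₁² X₂² ⋯ Xₙ²` (the empty word if the list is empty). -/
def prodSquares (Xs : List Word) : Word := (Xs.map fun X => X ++ X).flatten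

/-- The infinite word `s` is the infinite product `X₀² X₁² X₂² ⋯` of squares of nonempty words:
every finite product `X₀² ⋯ Xₙ₋₁²` is a prefix of `s`. -/
def IsInfProdSquares (X : ℕ → Word) (s : InfWord) : Prop :=
  (∀ i, X i ≠ []) ∧ ∀ n, ∃ t : InfWord, s = prodSquares ((List.range n).map X) ++ₛ t

end SturmianSquares

end

namespace SturmianSquares

open List (replicate)
open Stream' (cons_append_stream append_append_stream)

/-! The proof is a descent along the substitutions 0 ↦ 10ᵇ, 1 ↦ 0, with b = a₁ - 1 and then b = a₂,
a₃, …. Reversed standard words are images of those for the shifted sequence of exponents, and a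
Sturmian word is, up to some initial zeros, the image of a coding of a renormalised interval
exchange. The class `IsRoot`, closed under these images, is RSSt(α) together with the words 10ˡ, 1 ≤
l < a₁ - 1. The latter are needed because at the next level their analogues have reversed
semistandard words as images. Their own squares never begin a word of slope α
(`IsCoding.not_isPre_semi`).

Three facts suffice. Squares of different roots are never prefixes of the same word
(`IsRoot.eq_of_isPre`), which gives uniqueness. The substitution exchanges the words 01c and 10c of
consecutive levels, so neither of them begins with the square of a root (`IsRoot.not_isPre`); hence
the two kinds of factorisation exclude each other. Finally, every coding other than 01c and 10c
begins with the square of a root (`IsCoding.exists_root`): under repeated desubstitution either a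
square appears, or each level adds a letter to the agreement with 01c or 10c. Removing a square
leaves a coding, so the factorisation continues forever unless it reaches one of the two exceptional
words. -/

/-! ### Prefixes of infinite words and the substitutions -/

/-- The finite word `w` is a prefix of the infinite word `s`. -/
def IsPre (w : Word) (s : InfWord) : Prop := ∃ t : InfWord, s = w ++ₛ t

/-- The image of a letter under the substitution `0 ↦ 10ᵇ`, `1 ↦ 0`. -/
def block (b : ℕ) (x : Fin 2) : Word := if x = 0 then 1 :: replicate b 0 else [0]

/-- The substitution `0 ↦ 10ᵇ`, `1 ↦ 0`. -/
def subst (b : ℕ) (w : Word) : Word := w.flatMap (block b)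

/-- The image of a letter under the reversed substitution `0 ↦ 0ᵇ1`, `1 ↦ 0`. -/
def coblock (b : ℕ) (x : Fin 2) : Word := if x = 0 then replicate b 0 ++ [1] else [0]

/-- The reversed substitution `0 ↦ 0ᵇ1`, `1 ↦ 0`. -/
def cosubst (b : ℕ) (w : Word) : Word := w.flatMap (coblock b)

/-- The infinite word `t` is the image of the infinite word `u` under `subst b`. -/
def IsImage (b : ℕ) (u t : InfWord) : Prop := ∀ n, IsPre (subst b (u.take n)) t

/-- The shift of a sequence of partial quotients. -/
abbrev shift (b : ℕ → ℕ) : ℕ → ℕ := fun n => b (n + 1)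

@[simp] theorem block_zero (b : ℕ) : block b 0 = 1 :: replicate b 0 := rfl
@[simp] theorem block_one (b : ℕ) : block b 1 = [0] := rfl
@[simp] theorem coblock_zero (b : ℕ) : coblock b 0 = replicate b 0 ++ [1] := rfl
@[simp] theorem coblock_one (b : ℕ) : coblock b 1 = [0] := rfl

@[simp] theorem subst_nil (b : ℕ) : subst b [] = [] := rfl
@[simp] theorem subst_cons (b : ℕ) (x : Fin 2) (w : Word) :
    subst b (x :: w) = block b x ++ subst b w := rfl
@[simp] theorem subst_append (b : ℕ) (v w : Word) :
    subst b (v ++ w) = subst b v ++ subst b w := List.flatMap_append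
@[simp] theorem cosubst_nil (b : ℕ) : cosubst b [] = [] := rfl
@[simp] theorem cosubst_cons (b : ℕ) (x : Fin 2) (w : Word) :
    cosubst b (x :: w) = coblock b x ++ cosubst b w := rfl
@[simp] theorem cosubst_append (b : ℕ) (v w : Word) :
    cosubst b (v ++ w) = cosubst b v ++ cosubst b w := List.flatMap_append

theorem fin2_cases (x : Fin 2) : x = 0 ∨ x = 1 := by omega

theorem exists_cons (s : InfWord) : ∃ x t, s = Stream'.cons x t :=
  ⟨s.head, s.tail, (Stream'.eta s).symm⟩

theorem cons_inj {x y : Fin 2} {s t : InfWord} (h : Stream'.cons x s = Stream'.cons y t) :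
    x = y ∧ s = t :=
  Stream'.cons_injective2 h

@[simp] theorem isPre_nil (s : InfWord) : IsPre [] s := ⟨s, rfl⟩

theorem isPre_cons {x y : Fin 2} {w : Word} {s : InfWord} :
    IsPre (x :: w) (Stream'.cons y s) ↔ x = y ∧ IsPre w s := by
  constructor
  · rintro ⟨t, ht⟩
    rw [cons_append_stream] at ht
    obtain ⟨rfl, rfl⟩ := cons_inj ht
    exact ⟨rfl, t, rfl⟩
  · rintro ⟨rfl, t, rfl⟩
    exact ⟨t, rfl⟩

theorem isPre_append {v w : Word} {s : InfWord} :
    IsPre (v ++ w) (v ++ₛ s) ↔ IsPre w s := by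
  induction v with
  | nil => rfl
  | cons x v ih => rw [cons_append_stream, List.cons_append, isPre_cons]; simpa using ih

theorem isPre_take (n : ℕ) (s : InfWord) : IsPre (s.take n) s :=
  ⟨s.drop n, (Stream'.append_take_drop n s).symm⟩

theorem isPre_iff_take {w : Word} {s : InfWord} : IsPre w s ↔ s.take w.length = w := by
  constructor
  · rintro ⟨t, rfl⟩
    rw [Stream'.take_append_of_le_length _ _ _ le_rfl]; simp
  · intro h; rw [← h]; exact isPre_take _ _

theorem IsPre.of_prefix {v w : Word} {s : InfWord} (h : IsPre w s) (hv : v <+: w) :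
    IsPre v s := by
  obtain ⟨r, rfl⟩ := hv
  obtain ⟨t, rfl⟩ := h
  exact ⟨r ++ₛ t, append_append_stream _ _ _⟩

theorem IsPre.prefix {v w : Word} {s : InfWord} (hv : IsPre v s) (hw : IsPre w s)
    (h : v.length ≤ w.length) : v <+: w := by
  rw [isPre_iff_take] at hv hw
  rw [← hv, ← hw]
  obtain ⟨k, hk⟩ := Nat.exists_eq_add_of_le h
  rw [hk, Stream'.take_add]
  exact List.prefix_append _ _

theorem eq_of_isPre {s t : InfWord} (h : ∀ n, IsPre (s.take n) t) : s = t := by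
  apply Stream'.take_theorem
  intro n
  have := isPre_iff_take.1 (h n)
  simpa using this.symm

theorem length_le_subst (b : ℕ) (w : Word) : w.length ≤ (subst b w).length := by
  induction w with
  | nil => simp
  | cons x w ih => obtain rfl | rfl := fin2_cases x <;> simp <;> omega

theorem length_lt_subst {b : ℕ} (hb : 1 ≤ b) {w : Word} (h : 0 ∈ w) :
    w.length + 1 ≤ (subst b w).length := by
  induction w with
  | nil => simp at h
  | cons x w ih =>
    have := length_le_subst b w
    obtain rfl | rfl := fin2_cases x
    · simp; omega
    · have := ih (by simpa using h)
      simp; omega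

/-- The two blocks begin with different letters, so an image can be decoded from the left. -/
theorem prefix_of_subst {b : ℕ} {v w : Word} (h : subst b v <+: subst b w) : v <+: w := by
  induction v generalizing w with
  | nil => simp
  | cons x v ih =>
    cases w with
    | nil => obtain rfl | rfl := fin2_cases x <;> simp at h
    | cons y w =>
      obtain rfl | rfl := fin2_cases x <;> obtain rfl | rfl := fin2_cases y <;>
        simp_all

theorem IsImage.isPre_of_subst {b : ℕ} {u t : InfWord} (h : IsImage b u t) {w : Word}
    (hw : IsPre (subst b w) t) : IsPre w u := by
  have h1 := h (subst b w).length
  have h2 : subst b w <+: subst b (u.take (subst b w).length) := by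
    refine hw.prefix h1 ?_
    have := length_le_subst b (u.take (subst b w).length)
    simpa using this
  exact (isPre_take _ _).of_prefix (prefix_of_subst h2)

theorem IsImage.isPre_subst {b : ℕ} {u t : InfWord} (h : IsImage b u t) {w : Word}
    (hw : IsPre w u) : IsPre (subst b w) t := by
  rw [isPre_iff_take] at hw
  rw [← hw]; exact h _

theorem IsImage.cons {b : ℕ} {u t : InfWord} (h : IsImage b u t) (x : Fin 2) :
    IsImage b (Stream'.cons x u) (block b x ++ₛ t) := by
  intro n
  cases n with
  | zero => simp
  | succ n => rw [Stream'.take_succ_cons, subst_cons, isPre_append]; exact h n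

theorem IsImage.exists_of_cons {b : ℕ} {x : Fin 2} {u t : InfWord}
    (h : IsImage b (Stream'.cons x u) t) : ∃ r, t = block b x ++ₛ r ∧ IsImage b u r := by
  obtain ⟨r, hr⟩ := h 1
  simp only [Stream'.take_succ_cons, Stream'.take_zero, subst_cons, subst_nil,
    List.append_nil] at hr
  refine ⟨r, hr, fun n => ?_⟩
  have := h (n + 1)
  rwa [Stream'.take_succ_cons, subst_cons, hr, isPre_append] at this

/-! ### The roots of the squares -/

/-- The roots of the squares for the sequence `b` of exponents: `0`, the words `10ˡ` with
`1 ≤ l < b₀`, and the images under `subst b₀` of the roots for the shifted sequence. -/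
inductive IsRoot : (ℕ → ℕ) → Word → Prop
  | zero (b : ℕ → ℕ) : IsRoot b [0]
  | semi (b : ℕ → ℕ) (l : ℕ) : 1 ≤ l → l < b 0 → IsRoot b (1 :: replicate l 0)
  | image (b : ℕ → ℕ) (X : Word) : IsRoot (shift b) X → IsRoot b (subst (b 0) X)

theorem replicate_lt_prefix {l m : ℕ} {v w : Word}
    (h : replicate l (0 : Fin 2) ++ 1 :: v <+: replicate m 0 ++ w) : m ≤ l := by
  by_contra! hlt
  obtain ⟨k, rfl⟩ := Nat.exists_eq_add_of_lt hlt
  rw [add_assoc, List.replicate_add, List.append_assoc, List.prefix_append_right_inj,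
    List.replicate_succ, List.cons_append, List.cons_prefix_cons] at h
  simp at h

/-- The shape of a root, as far as needed to compare squares. -/
theorem IsRoot.shape {b : ℕ → ℕ} (hb : ∀ k, 1 ≤ b k) {X : Word} (h : IsRoot b X) :
    X = [0] ∨ (∃ w, X = 0 :: 1 :: w) ∨ ∃ w, X = 1 :: 0 :: w := by
  induction h with
  | zero b => exact Or.inl rfl
  | semi b l h1 h2 =>
    obtain ⟨l, rfl⟩ := Nat.exists_eq_add_of_le' h1
    exact Or.inr (Or.inr ⟨_, by rw [List.replicate_succ]⟩)
  | image b X hX ih =>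
    obtain ⟨m, hm⟩ := Nat.exists_eq_add_of_le' (hb 0)
    rcases ih (fun k => hb (k + 1)) with rfl | ⟨w, rfl⟩ | ⟨w, rfl⟩
    · right; right; simp [hm, List.replicate_succ]
    · right; right; simp [hm, List.replicate_succ]
    · right; left; simp

theorem IsRoot.ne_nil {b : ℕ → ℕ} (hb : ∀ k, 1 ≤ b k) {X : Word} (h : IsRoot b X) :
    X ≠ [] := by
  rcases h.shape hb with rfl | ⟨w, rfl⟩ | ⟨w, rfl⟩ <;> simp

/-- A root whose square begins with `00` is `0`. -/
theorem IsRoot.eq_zero {b : ℕ → ℕ} (hb : ∀ k, 1 ≤ b k) {X : Word} (h : IsRoot b X)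
    (h0 : [0, 0] <+: X ++ X) : X = [0] := by
  rcases h.shape hb with rfl | ⟨w, rfl⟩ | ⟨w, rfl⟩
  · rfl
  · simp at h0
  · simp at h0

/-- In an image, two successive letters 1 are separated by at least c zeros. -/
theorem not_semi_prefix_subst {l c : ℕ} (hl : l < c) {v w : Word} :
    ¬ (1 :: (replicate l (0 : Fin 2) ++ 1 :: v) <+: subst c w) := by
  intro h
  cases w with
  | nil => simp at h
  | cons x w =>
    obtain rfl | rfl := fin2_cases x
    · simp only [subst_cons, block_zero, List.cons_append, List.cons_prefix_cons] at h
      have := replicate_lt_prefix h.2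
      omega
    · simp at h

theorem replicate_one_inj {l m : ℕ} {v w : Word}
    (h : replicate l (0 : Fin 2) ++ 1 :: v <+: replicate m 0 ++ 1 :: w) : l = m := by
  have h1 := replicate_lt_prefix h
  obtain ⟨k, rfl⟩ := Nat.exists_eq_add_of_le h1
  rw [List.replicate_add, List.append_assoc, List.prefix_append_right_inj] at h
  cases k with
  | zero => rfl
  | succ k => simp [List.replicate_succ] at h

/-- Two images are decoded and compared one level down; a root 10ˡ is told apart from an image by
its first run of zeros, which is too short. -/
theorem IsRoot.eq_of_prefix {b : ℕ → ℕ} (hb : ∀ k, 1 ≤ b k) {X Y : Word} (hX : IsRoot b X)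
    (hY : IsRoot b Y) (h : X ++ X <+: Y ++ Y) : X = Y := by
  induction hX generalizing Y with
  | zero b => exact (hY.eq_zero hb h).symm
  | semi b l h1 h2 =>
    cases hY with
    | zero => simp at h
    | semi _ m h3 h4 =>
      simp only [List.cons_append, List.cons_prefix_cons] at h
      rw [replicate_one_inj h.2]
    | image _ Y hY =>
      rw [← subst_append, List.cons_append] at h
      exact (not_semi_prefix_subst h2 h).elim
  | image b X hX ih =>
    have hb' : ∀ k, 1 ≤ shift b k := fun k => hb (k + 1)
    cases hY with
    | zero =>
      have h1 := h.length_le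
      have h3 := (IsRoot.image b X hX).shape hb
      rcases h3 with h3 | ⟨w, h3⟩ | ⟨w, h3⟩
      · exact h3
      · rw [h3] at h1; simp at h1
      · rw [h3] at h1; simp at h1
    | semi _ m h3 h4 =>
      exfalso
      rw [← subst_append] at h
      -- With b = b₀, the image of the square begins with 10ᵇ1, 10ᵇ0 or 0, none of which is
      -- compatible with 10ᵐ1 for m < b.
      rcases hX.shape hb' with rfl | ⟨w, rfl⟩ | ⟨w, rfl⟩
      · simp only [List.cons_append, subst_cons, block_zero, List.cons_prefix_cons,
          List.nil_append] at h
        have := replicate_one_inj h.2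
        omega
      · simp only [List.cons_append, subst_cons, block_zero, List.cons_prefix_cons, block_one,
          List.nil_append] at h
        obtain ⟨k, hk⟩ := Nat.exists_eq_add_of_lt h4
        rw [hk, add_assoc, List.replicate_add, List.append_assoc, List.prefix_append_right_inj,
          List.replicate_succ] at h
        simp at h
      · simp at h
    | image _ Y hY =>
      rw [← subst_append, ← subst_append] at h
      rw [ih hb' hY (prefix_of_subst h)]

theorem IsRoot.eq_of_isPre {b : ℕ → ℕ} (hb : ∀ k, 1 ≤ b k) {X Y : Word} (hX : IsRoot b X)
    (hY : IsRoot b Y) {s : InfWord} (h : IsPre (X ++ X) s) (h' : IsPre (Y ++ Y) s) : X = Y := by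
  rcases le_total (X ++ X).length (Y ++ Y).length with hl | hl
  · exact hX.eq_of_prefix hb hY (h.prefix h' hl)
  · exact (hY.eq_of_prefix hb hX (h'.prefix h hl)).symm

/-! ### The standard words and their limit -/

/-- The standard words for the sequence `b` of exponents. -/
def std (b : ℕ → ℕ) : ℕ → Word
  | 0 => [0]
  | k + 1 => cosubst (b 0) (std (fun n => b (n + 1)) k)
termination_by structural k => k

/-- The limit of the standard words. -/
def stdInf (b : ℕ → ℕ) : InfWord := fun n => (std b (n + 1)).getD n 0

theorem std_succ (b : ℕ → ℕ) (k : ℕ) : std b (k + 1) = cosubst (b 0) (std (shift b) k) := rfl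

theorem zero_mem_cosubst {b : ℕ} (hb : 1 ≤ b) {w : Word} (h : 0 ∈ w) : 0 ∈ cosubst b w := by
  rw [cosubst, List.mem_flatMap]
  exact ⟨0, h, by simp; omega⟩

theorem length_lt_cosubst {b : ℕ} (hb : 1 ≤ b) {w : Word} (h : 0 ∈ w) :
    w.length + 1 ≤ (cosubst b w).length := by
  have key : ∀ w : Word, (cosubst b w).length = (subst b w).length := by
    intro w
    induction w with
    | nil => rfl
    | cons x w ih =>
      obtain rfl | rfl := fin2_cases x
      · simp [ih]; omega
      · simp [ih]
  rw [key]; exact length_lt_subst hb h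

theorem zero_mem_std {b : ℕ → ℕ} (hb : ∀ k, 1 ≤ b k) (k : ℕ) : 0 ∈ std b k := by
  induction k generalizing b with
  | zero => simp [std]
  | succ k ih => exact zero_mem_cosubst (hb 0) (ih fun k => hb (k + 1))

theorem lt_length_std {b : ℕ → ℕ} (hb : ∀ k, 1 ≤ b k) (k : ℕ) : k < (std b k).length := by
  induction k generalizing b with
  | zero => simp [std]
  | succ k ih =>
    have hb' : ∀ k, 1 ≤ shift b k := fun k => hb (k + 1)
    have := length_lt_cosubst (hb 0) (zero_mem_std hb' k)
    have := ih hb'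
    rw [std_succ]
    omega

theorem cosubst_prefix (b : ℕ) {v w : Word} (h : v <+: w) : cosubst b v <+: cosubst b w := by
  obtain ⟨r, rfl⟩ := h
  rw [cosubst_append]; exact List.prefix_append _ _

theorem std_prefix_succ {b : ℕ → ℕ} (hb : ∀ k, 1 ≤ b k) (k : ℕ) :
    std b (k + 1) <+: std b (k + 2) := by
  induction k generalizing b with
  | zero =>
    obtain ⟨m, hm⟩ := Nat.exists_eq_add_of_le' (hb 1)
    simp [std, hm, List.replicate_succ]
  | succ k ih => exact cosubst_prefix _ (ih fun k => hb (k + 1))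

theorem std_prefix {b : ℕ → ℕ} (hb : ∀ k, 1 ≤ b k) {k m : ℕ} (h : k ≤ m) :
    std b (k + 1) <+: std b (m + 1) := by
  induction m, h using Nat.le_induction with
  | base => exact List.prefix_rfl
  | succ m _ ih => exact ih.trans (std_prefix_succ hb m)

theorem take_stdInf {b : ℕ → ℕ} (hb : ∀ k, 1 ≤ b k) {n k : ℕ} (h : n ≤ k) :
    (stdInf b).take n <+: std b (k + 1) := by
  have hl : (stdInf b).take n = (std b (k + 1)).take n := by
    have hk := lt_length_std hb (k + 1)
    apply List.ext_getElem
    · simp; omega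
    · intro i h1 h2
      have hi : i < n := by simpa using h1
      have e := Stream'.getElem?_take (s := stdInf b) hi
      rw [List.getElem?_eq_getElem h1, Option.some_inj] at e
      rw [e, List.getElem_take]
      have hi' := lt_length_std hb (i + 1)
      have := (std_prefix hb (show i ≤ k by omega)).getElem (show i < _ by omega)
      rw [← this]
      simp only [Stream'.get, stdInf]
      rw [List.getD_eq_getElem _ _ (by omega)]
  rw [hl]; exact List.take_prefix _ _

theorem isPre_stdInf {b : ℕ → ℕ} (hb : ∀ k, 1 ≤ b k) (k : ℕ) :
    IsPre (std b (k + 1)) (stdInf b) := by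
  have h1 := take_stdInf hb (le_max_left (std b (k + 1)).length k)
  have h2 := std_prefix hb (le_max_right (std b (k + 1)).length k)
  have : std b (k + 1) <+: (stdInf b).take (std b (k + 1)).length := by
    apply List.prefix_of_prefix_length_le h2 h1; simp
  exact (isPre_take _ _).of_prefix this

/-- The two substitutions are conjugate, since 0ᵇ·10ᵇ = 0ᵇ1·0ᵇ and 0ᵇ·0 = 0·0ᵇ. This transfers the
limit of standard words, built with `cosubst`, to `subst`. -/
theorem replicate_append_subst (b : ℕ) (w : Word) :
    replicate b 0 ++ subst b w = cosubst b w ++ replicate b 0 := by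
  induction w with
  | nil => simp
  | cons x w ih =>
    obtain rfl | rfl := fin2_cases x
    · simp [← ih]
    · rw [cosubst_cons, List.append_assoc, ← ih, subst_cons, ← List.append_assoc,
        ← List.append_assoc]
      congr 1
      simp [← List.replicate_succ, ← List.replicate_succ']

theorem isImage_stdInf {b : ℕ → ℕ} (hb : ∀ k, 1 ≤ b k) :
    ∃ r, stdInf b = replicate (b 0) 0 ++ₛ r ∧ IsImage (b 0) (stdInf (shift b)) r := by
  have hb' : ∀ k, 1 ≤ shift b k := fun k => hb (k + 1)
  have key : ∀ n, IsPre (replicate (b 0) 0 ++ subst (b 0) ((stdInf (shift b)).take n))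
      (stdInf b) := by
    intro n
    set w := (stdInf (shift b)).take n with hw
    set v := replicate (b 0) 0 ++ subst (b 0) w with hv
    let m := max n v.length
    obtain ⟨r, hr⟩ : w <+: std (shift b) (m + 1) := take_stdInf hb' (le_max_left _ _)
    have h1 : v <+: std b (m + 2) ++ replicate (b 0) 0 := by
      rw [std_succ, ← replicate_append_subst, ← hr, subst_append, ← List.append_assoc]
      exact List.prefix_append _ _
    -- The final 0ᵇ in `h1` is out of reach, because v has at most m letters.
    have h2 : v <+: std b (m + 2) := by
      refine List.prefix_of_prefix_length_le h1 (List.prefix_append _ _) ?_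
      have := lt_length_std hb (m + 2)
      have : v.length ≤ m := le_max_right _ _
      omega
    exact (isPre_stdInf hb (m + 1)).of_prefix h2
  obtain ⟨r, hr⟩ := key 0
  simp only [Stream'.take_zero, subst_nil, List.append_nil] at hr
  refine ⟨r, hr, fun n => ?_⟩
  have := key n
  rwa [hr, isPre_append] at this

/-- The image of 01 is 10ᵇ·0 = 10·0ᵇ, and 0ᵇ is the prefix that separates `stdInf b` from the image
of its predecessor. -/
theorem isImage_zero_one {b : ℕ → ℕ} (hb : ∀ k, 1 ≤ b k) :
    IsImage (b 0) ([0, 1] ++ₛ stdInf (shift b)) ([1, 0] ++ₛ stdInf b) := by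
  obtain ⟨r, hr, h⟩ := isImage_stdInf hb
  have := (h.cons 1).cons 0
  change IsImage _ (Stream'.cons _ (Stream'.cons _ (stdInf (shift b)))) _
  convert this using 1
  rw [hr, ← append_append_stream, ← append_append_stream]
  congr 1
  simp [← List.replicate_succ, ← List.replicate_succ']

theorem isImage_one_zero {b : ℕ → ℕ} (hb : ∀ k, 1 ≤ b k) :
    IsImage (b 0) ([1, 0] ++ₛ stdInf (shift b)) ([0, 1] ++ₛ stdInf b) := by
  obtain ⟨r, hr, h⟩ := isImage_stdInf hb
  have := (h.cons 0).cons 1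
  change IsImage _ (Stream'.cons _ (Stream'.cons _ (stdInf (shift b)))) _
  convert this using 1
  rw [hr, ← append_append_stream, ← append_append_stream]
  congr 1

/-- Decoding exchanges the two words, so both claims are carried through the induction together. -/
theorem IsRoot.not_isPre {b : ℕ → ℕ} (hb : ∀ k, 1 ≤ b k) {X : Word} (hX : IsRoot b X) :
    ¬ IsPre (X ++ X) ([0, 1] ++ₛ stdInf b) ∧ ¬ IsPre (X ++ X) ([1, 0] ++ₛ stdInf b) := by
  induction hX with
  | zero b => simp [cons_append_stream, isPre_cons]
  | semi b l h1 h2 =>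
    refine ⟨by simp [cons_append_stream, isPre_cons], fun h => ?_⟩
    have h3 := (isImage_zero_one hb) (b 0 + l + 2)
    have h4 := h.prefix h3 (by
      refine le_trans ?_ (length_le_subst _ _)
      simp; omega)
    exact not_semi_prefix_subst h2 h4
  | image b X hX ih =>
    obtain ⟨h1, h2⟩ := ih fun k => hb (k + 1)
    rw [← subst_append]
    exact ⟨fun h => h2 ((isImage_one_zero hb).isPre_of_subst h),
      fun h => h1 ((isImage_zero_one hb).isPre_of_subst h)⟩
/-! ### Codings of two-interval exchanges -/

/-- Nonnegativity for `e = true` and positivity for `e = false`. -/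
def IsPos : Bool → ℝ → Prop
  | true, z => 0 ≤ z
  | false, z => 0 < z

theorem isPos_not_neg (e : Bool) (z : ℝ) : IsPos (!e) (-z) ↔ ¬ IsPos e z := by
  cases e <;> simp [IsPos]

theorem IsPos.mono {e : Bool} {y z : ℝ} (h : IsPos e y) (hyz : y ≤ z) : IsPos e z := by
  cases e <;> simp only [IsPos] at * <;> linarith

open Classical in
/-- The exchange of the two intervals of lengths `l` (left of `0`) and `m` (right of `0`). -/
noncomputable def exchange (e : Bool) (l m y : ℝ) : ℝ := if IsPos e y then y - l else y + m

open Classical in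
/-- The coding of the orbit of `y` under the exchange of two intervals. -/
noncomputable def coding (e : Bool) (l m y : ℝ) : InfWord :=
  fun n => if IsPos e ((exchange e l m)^[n] y) then 1 else 0

/-- `y` is in the domain of the exchange of two intervals. -/
def InDomain (e : Bool) (l m y : ℝ) : Prop := IsPos e (y + l) ∧ ¬ IsPos e (y - m)

theorem coding_of_pos {e : Bool} {l m y : ℝ} (h : IsPos e y) :
    coding e l m y = Stream'.cons 1 (coding e l m (y - l)) := by
  classical
  funext n
  cases n with
  | zero => simp [coding, h, Stream'.cons]
  | succ n =>
    have h1 : (exchange e l m)^[n + 1] y = (exchange e l m)^[n] (y - l) := by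
      rw [Function.iterate_succ_apply, show exchange e l m y = y - l from if_pos h]
    exact if_congr (by rw [h1]) rfl rfl

theorem coding_of_not_pos {e : Bool} {l m y : ℝ} (h : ¬ IsPos e y) :
    coding e l m y = Stream'.cons 0 (coding e l m (y + m)) := by
  classical
  funext n
  cases n with
  | zero => simp [coding, h, Stream'.cons]
  | succ n =>
    have h1 : (exchange e l m)^[n + 1] y = (exchange e l m)^[n] (y + m) := by
      rw [Function.iterate_succ_apply, show exchange e l m y = y + m from if_neg h]
    exact if_congr (by rw [h1]) rfl rfl

theorem coding_run {e : Bool} {l m z : ℝ} (j : ℕ) (h : ∀ i < j, ¬ IsPos e (z + i * m)) :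
    coding e l m z = replicate j 0 ++ₛ coding e l m (z + j * m) := by
  induction j with
  | zero => simp
  | succ j ih =>
    rw [ih fun i hi => h i (by omega), coding_of_not_pos (h j (by omega)),
      List.replicate_succ', append_append_stream, Nat.cast_succ, add_mul, one_mul, ← add_assoc]
    rfl

theorem InDomain.sub {e : Bool} {l m y : ℝ} (hl : 0 < l) (h : InDomain e l m y)
    (hy : IsPos e y) : InDomain e l m (y - l) :=
  ⟨by simpa using hy, fun h' => h.2 (h'.mono (by linarith))⟩

theorem InDomain.add {e : Bool} {l m y : ℝ} (hm : 0 < m) (h : InDomain e l m y)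
    (hy : ¬ IsPos e y) : InDomain e l m (y + m) :=
  ⟨h.1.mono (by linarith), by simpa using hy⟩

/-- Renormalisation: the domain of the exchange induced on a subinterval, after a reflection. -/
theorem inDomain_neg {e : Bool} {l m y : ℝ} :
    InDomain (!e) m l (-y) ↔ InDomain e l m y := by
  have h1 : -y + m = -(y - m) := by ring
  have h2 : -y - l = -(y + l) := by ring
  rw [InDomain, InDomain, h1, h2, isPos_not_neg, isPos_not_neg, not_not, and_comm]

/-- This is the first return to the interval from -(l - bm) to m: from the right of 0 the orbit
makes one jump by -l and b steps by m, reading 10ᵇ; from the left it returns at once, reading 0. The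
reflection y ↦ -y swaps the letters and the endpoint convention, whence `!e`. -/
theorem isImage_coding {e : Bool} {l m y : ℝ} {b : ℕ} (hm : 0 < m) (hb : b * m < l)
    (h : InDomain e (l - b * m) m y) :
    IsImage b (coding (!e) m (l - b * m) (-y)) (coding e l m y) := by
  intro n
  induction n generalizing y with
  | zero => simp
  | succ n ih =>
    by_cases hy : IsPos e y
    · have hy' : ¬ IsPos (!e) (-y) := by rw [isPos_not_neg]; simpa using hy
      have hrun : ∀ i < b, ¬ IsPos e (y - l + i * m) := by
        intro i hi hi'
        refine h.2 (hi'.mono ?_)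
        have : (i : ℝ) + 1 ≤ b := by exact_mod_cast hi
        nlinarith
      have e1 : -y + (l - b * m) = -(y - l + b * m) := by ring
      rw [coding_of_not_pos hy', Stream'.take_succ_cons, coding_of_pos hy,
        coding_run b hrun, e1, subst_cons, block_zero, List.cons_append, isPre_cons, isPre_append]
      refine ⟨rfl, ih ?_⟩
      have := h.sub (by linarith) hy
      rwa [← sub_add] at this
    · have hy' : IsPos (!e) (-y) := by rwa [isPos_not_neg]
      have e1 : -y - m = -(y + m) := by ring
      rw [coding_of_pos hy', Stream'.take_succ_cons, coding_of_not_pos hy, e1, subst_cons,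
        block_one, List.cons_append, isPre_cons]
      exact ⟨rfl, ih (h.add hm hy)⟩

/-- `t` codes an orbit of the exchange of two intervals of lengths `l` and `m`. -/
def IsCoding (l m : ℝ) (t : InfWord) : Prop := ∃ e y, InDomain e l m y ∧ t = coding e l m y

theorem IsCoding.of_cons {l m : ℝ} (hl : 0 < l) (hm : 0 < m) {x : Fin 2} {t : InfWord}
    (h : IsCoding l m (Stream'.cons x t)) : IsCoding l m t := by
  obtain ⟨e, y, hy, ht⟩ := h
  by_cases hp : IsPos e y
  · rw [coding_of_pos hp] at ht
    exact ⟨e, _, hy.sub hl hp, (cons_inj ht).2⟩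
  · rw [coding_of_not_pos hp] at ht
    exact ⟨e, _, hy.add hm hp, (cons_inj ht).2⟩

theorem IsCoding.of_append {l m : ℝ} (hl : 0 < l) (hm : 0 < m) {w : Word} {t : InfWord}
    (h : IsCoding l m (w ++ₛ t)) : IsCoding l m t := by
  induction w with
  | nil => exact h
  | cons x w ih => exact ih (IsCoding.of_cons hl hm h)

theorem IsCoding.zero_of_one {l m : ℝ} (hml : m < l) {t : InfWord}
    (h : IsCoding l m (Stream'.cons 1 t)) : ∃ r, t = Stream'.cons 0 r := by
  obtain ⟨e, y, hy, ht⟩ := h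
  by_cases hp : IsPos e y
  · rw [coding_of_pos hp] at ht
    refine ⟨_, (cons_inj ht).2.trans (coding_of_not_pos fun h' => hy.2 (h'.mono ?_))⟩
    linarith
  · rw [coding_of_not_pos hp] at ht
    exact absurd (cons_inj ht).1 (by decide)

/-- A starting point outside the induced interval lies in the middle of a block: it is on the orbit
of some z to the right of 0, and only the last j zeros of the block 10ᵇ of z remain. -/
theorem IsCoding.desubst {l m : ℝ} {b : ℕ} (hm : 0 < m) (hb : b * m < l) {t : InfWord}
    (h : IsCoding l m t) :
    (∃ u, IsCoding m (l - b * m) u ∧ IsImage b u t) ∨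
      ∃ w r j, 1 ≤ j ∧ j ≤ b ∧ IsCoding m (l - b * m) (Stream'.cons 0 w) ∧ IsImage b w r ∧
        t = replicate j 0 ++ₛ r := by
  obtain ⟨e, y, hy, rfl⟩ := h
  by_cases hp : IsPos e (y + (l - b * m))
  · exact Or.inl ⟨_, ⟨!e, -y, inDomain_neg.2 ⟨hp, hy.2⟩, rfl⟩, isImage_coding hm hb ⟨hp, hy.2⟩⟩
  right
  have hex : ∃ k : ℕ, ¬ IsPos e (y + l - k * m) := ⟨b, by rwa [← add_sub_assoc] at hp⟩
  classical
  obtain ⟨k, hk, hmin⟩ : ∃ k : ℕ, ¬ IsPos e (y + l - k * m) ∧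
      ∀ i < k, IsPos e (y + l - i * m) :=
    ⟨Nat.find hex, Nat.find_spec hex, fun i hi => by simpa using Nat.find_min hex hi⟩
  cases k with
  | zero => exact absurd hy.1 (by simpa using hk)
  | succ i =>
    have hib : i < b := by
      by_contra! hbi
      exact hp ((hmin b (by omega)).mono (by linarith))
    have hpi := hmin i (by omega)
    -- The orbit of z jumps to z - l and reaches y after i further steps by m, so b - i zeros of its
    -- block are left.
    set z := y + l - i * m with hz
    have hz0 : InDomain e (l - b * m) m z := by
      refine ⟨hpi.mono (by linarith), ?_⟩
      convert hk using 2
      push_cast; ring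
    have hz' : ¬ IsPos (!e) (-z) := by rw [isPos_not_neg]; simpa using hpi
    have e1 : -z + (l - b * m) = -(z - (l - b * m)) := by ring
    refine ⟨_, _, b - i, by omega, by omega, ⟨!e, -z, inDomain_neg.2 hz0, ?_⟩,
      isImage_coding hm hb (hz0.sub (by linarith) hpi), ?_⟩
    · rw [coding_of_not_pos hz', e1]
    · have e2 : z - (l - b * m) = y + (b - i : ℕ) * m := by
        rw [Nat.cast_sub hib.le, hz]; ring
      rw [e2]
      apply coding_run
      intro j hj hj'
      refine hk (hj'.mono ?_)
      have : (j : ℝ) + i + 1 ≤ b := by exact_mod_cast (by omega : j + i + 1 ≤ b)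
      push_cast
      nlinarith
/-! ### Existence of square prefixes -/

/-- `l` is the sequence of interval lengths and `b` the sequence of exponents in the
renormalisation of an exchange of two intervals. -/
def IsChain (b : ℕ → ℕ) (l : ℕ → ℝ) : Prop :=
  ∀ k, 1 ≤ b k ∧ 0 < l k ∧ l (k + 1) < l k ∧ l (k + 2) = l k - b k * l (k + 1)

theorem IsChain.shift {b : ℕ → ℕ} {l : ℕ → ℝ} (h : IsChain b l) :
    IsChain (shift b) (fun n => l (n + 1)) :=
  fun k => h (k + 1)

theorem IsChain.mul_lt {b : ℕ → ℕ} {l : ℕ → ℝ} (h : IsChain b l) : b 0 * l 1 < l 0 := by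
  have h1 := (h 0).2.2.2
  have h2 := (h 2).2.1
  simp only [zero_add] at h1
  linarith

/-- `t` codes an orbit, or arises from such a word beginning with `0` by prefixing `1`. -/
def IsExtCoding (l m : ℝ) (t : InfWord) : Prop :=
  IsCoding l m t ∨ ∃ v, IsCoding l m (Stream'.cons 0 v) ∧ t = Stream'.cons 1 (Stream'.cons 0 v)

theorem IsCoding.desubst_chain {b : ℕ → ℕ} {l : ℕ → ℝ} (h : IsChain b l) {t : InfWord}
    (ht : IsCoding (l 0) (l 1) t) :
    (∃ u, IsCoding (l 1) (l 2) u ∧ IsImage (b 0) u t) ∨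
      ∃ w r j, 1 ≤ j ∧ j ≤ b 0 ∧ IsCoding (l 1) (l 2) (Stream'.cons 0 w) ∧
        IsImage (b 0) w r ∧ t = replicate j 0 ++ₛ r := by
  have := ht.desubst (h 1).2.1 h.mul_lt
  rwa [← (h 0).2.2.2] at this

theorem exists_root_zero {b : ℕ → ℕ} (t : InfWord) :
    ∃ X, IsRoot b X ∧ IsPre (X ++ X) (Stream'.cons 0 (Stream'.cons 0 t)) :=
  ⟨[0], IsRoot.zero b, by simp [isPre_cons]⟩

theorem exists_root_one {b : ℕ → ℕ} {j : ℕ} (hj : 1 ≤ j) (hjb : j ≤ b 0) (t : InfWord) :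
    ∃ X, IsRoot b X ∧ IsPre (X ++ X)
      (Stream'.cons 1 (replicate j 0 ++ₛ (Stream'.cons 1 (replicate (b 0) 0 ++ₛ t)))) := by
  refine ⟨1 :: replicate j 0, ?_, ?_⟩
  · rcases hjb.lt_or_eq with h | rfl
    · exact .semi b j hj h
    · simpa using IsRoot.image b [0] (.zero _)
  · obtain ⟨k, hk⟩ := Nat.exists_eq_add_of_le hjb
    rw [hk, List.replicate_add, append_append_stream]
    simp only [List.cons_append, isPre_cons, isPre_append, true_and]
    exact ⟨_, rfl⟩

/-- A truncated block with j = 1 followed by the image of w is the image of 1w, which need not be a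
coding; this forces the extended class. Conversely, a prefixed 1 completes a truncated block with j
= b₀ to a full one. All other truncations produce 00 or a square of some 10ʲ with j ≤ b₀. -/
theorem IsExtCoding.desubst {b : ℕ → ℕ} {l : ℕ → ℝ} (h : IsChain b l) {t : InfWord}
    (ht : IsExtCoding (l 0) (l 1) t) :
    (∃ X, IsRoot b X ∧ IsPre (X ++ X) t) ∨
      ∃ u, IsExtCoding (l 1) (l 2) u ∧ IsImage (b 0) u t := by
  have hl1 := (h 1).2.1
  have hl2 := (h 2).2.1
  have hl12 := (h 1).2.2.1
  rcases ht with ht | ⟨v, hv, rfl⟩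
  · rcases ht.desubst_chain h with ⟨u, hu, hut⟩ | ⟨w, r, j, hj, hjb, hw, hr, rfl⟩
    · exact .inr ⟨u, .inl hu, hut⟩
    · obtain ⟨x, w, rfl⟩ := exists_cons w
      obtain ⟨j, rfl⟩ := Nat.exists_eq_add_of_le' hj
      obtain rfl | rfl := fin2_cases x
      · cases j with
        | zero => exact .inr ⟨_, .inr ⟨w, hw.of_cons hl1 hl2, rfl⟩, hr.cons 1⟩
        | succ j => exact .inl (exists_root_zero _)
      · obtain ⟨r, rfl, -⟩ := hr.exists_of_cons
        refine .inl ?_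
        cases j <;> exact exists_root_zero _
  · rcases hv.desubst_chain h with ⟨u, hu, hut⟩ | ⟨w, r, j, hj, hjb, hw, hr, hvr⟩
    · obtain ⟨x, u, rfl⟩ := exists_cons u
      obtain ⟨r, hr, hur⟩ := hut.exists_of_cons
      obtain rfl | rfl := fin2_cases x
      · exact absurd (cons_inj hr).1 (by decide)
      · obtain ⟨u, rfl⟩ := hu.zero_of_one hl12
        obtain ⟨r, rfl, -⟩ := hur.exists_of_cons
        rw [(cons_inj hr).2]
        exact .inl (exists_root_one le_rfl (h 0).1 r)
    · rw [hvr]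
      rcases hjb.lt_or_eq with hlt | rfl
      · obtain ⟨x, w, rfl⟩ := exists_cons w
        obtain ⟨r, rfl, hwr⟩ := hr.exists_of_cons
        refine .inl ?_
        obtain rfl | rfl := fin2_cases x
        · exact exists_root_one hj hjb r
        · obtain ⟨w, rfl⟩ := (hw.of_cons hl1 hl2).zero_of_one hl12
          obtain ⟨r, rfl, -⟩ := hwr.exists_of_cons
          have := exists_root_one (b := b) (j := j + 1) (by omega) hlt r
          rwa [List.replicate_succ', append_append_stream] at this
      · exact .inr ⟨_, .inl hw, hr.cons 0⟩

/-- The block of 0 has at least two letters, so agreement gains a letter at each level. -/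
theorem take_eq_of_isImage {b : ℕ → ℕ} (hb : ∀ k, 1 ≤ b k) {u t u' t' : InfWord} {n : ℕ}
    (hu : IsImage (b 0) u t) (hu' : IsImage (b 0) u' t') (h : u.take n = u'.take n)
    (h0 : 0 ∈ u'.take n) : t.take (n + 1) = t'.take (n + 1) := by
  have h1 := hu n
  have h2 := hu' n
  rw [h] at h1
  have hl := length_lt_subst (hb 0) h0
  rw [Stream'.length_take] at hl
  have h3 := (isPre_take (n + 1) t).prefix h1 (by simpa using hl)
  have h4 := (isPre_take (n + 1) t').prefix h2 (by simpa using hl)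
  exact (List.prefix_of_prefix_length_le h3 h4 (by simp)).eq_of_length (by simp)

theorem IsExtCoding.exists_root_or_take {b : ℕ → ℕ} {l : ℕ → ℝ} (h : IsChain b l) {t : InfWord}
    (ht : IsExtCoding (l 0) (l 1) t) (n : ℕ) :
    (∃ X, IsRoot b X ∧ IsPre (X ++ X) t) ∨
      t.take (n + 2) = ([0, 1] ++ₛ stdInf b).take (n + 2) ∨
      t.take (n + 2) = ([1, 0] ++ₛ stdInf b).take (n + 2) := by
  induction n generalizing b l t with
  | zero =>
    rcases ht with ht | ⟨v, hv, rfl⟩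
    · obtain ⟨x, t, rfl⟩ := exists_cons t
      obtain rfl | rfl := fin2_cases x
      · obtain ⟨x, t, rfl⟩ := exists_cons t
        obtain rfl | rfl := fin2_cases x
        · exact .inl (exists_root_zero t)
        · exact .inr (.inl rfl)
      · obtain ⟨t, rfl⟩ := ht.zero_of_one (h 0).2.2.1
        exact .inr (.inr rfl)
    · exact .inr (.inr rfl)
  | succ n ih =>
    have hb : ∀ k, 1 ≤ b k := fun k => (h k).1
    rcases ht.desubst h with h' | ⟨u, hu, hut⟩
    · exact .inl h'
    · rcases ih h.shift hu with ⟨X, hX, hXu⟩ | h' | h'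
      · refine .inl ⟨_, hX.image b X, ?_⟩
        rw [← subst_append]
        exact hut.isPre_subst hXu
      · exact .inr (.inr (take_eq_of_isImage hb hut (isImage_zero_one hb) h'
          (by simp [cons_append_stream, Stream'.take_succ_cons])))
      · exact .inr (.inl (take_eq_of_isImage hb hut (isImage_one_zero hb) h'
          (by simp [cons_append_stream, Stream'.take_succ_cons])))

theorem IsCoding.exists_root {b : ℕ → ℕ} {l : ℕ → ℝ} (h : IsChain b l) {t : InfWord}
    (ht : IsCoding (l 0) (l 1) t) :
    (∃ X, IsRoot b X ∧ IsPre (X ++ X) t) ∨ t = [0, 1] ++ₛ stdInf b ∨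
      t = [1, 0] ++ₛ stdInf b := by
  by_contra! hne
  obtain ⟨h1, h2, h3⟩ := hne
  have key : ∀ s : InfWord, t ≠ s → ∃ n, ∀ m, n ≤ m → t.take m ≠ s.take m := by
    intro s hs
    by_contra! hc
    refine hs (Stream'.take_theorem _ _ fun n => ?_)
    obtain ⟨m, hnm, hm⟩ := hc n
    have := congrArg (List.take n) hm
    simpa [Stream'.take_take, hnm] using this
  obtain ⟨n, hn⟩ := key _ h2
  obtain ⟨m, hm⟩ := key _ h3
  -- The length is chosen beyond a disagreement with both words, as the alternative may depend on
  -- the length.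
  rcases IsExtCoding.exists_root_or_take h (.inl ht) (max n m) with ⟨X, hX, hXt⟩ | h' | h'
  · exact h1 X hX hXt
  · exact hn _ (le_trans (le_max_left n m) (Nat.le_add_right _ _)) h'
  · exact hm _ (le_trans (le_max_right n m) (Nat.le_add_right _ _)) h'

/-- A coding that begins with 1 is a full image, where runs of zeros between letters 1 have length
at least b₀. -/
theorem IsCoding.not_isPre_semi {b : ℕ → ℕ} {l : ℕ → ℝ} (h : IsChain b l) {t : InfWord}
    (ht : IsCoding (l 0) (l 1) t) {j : ℕ} (hj : j < b 0) :
    ¬ IsPre ((1 :: replicate j 0) ++ (1 :: replicate j 0)) t := by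
  intro hp
  rcases ht.desubst_chain h with ⟨u, hu, hut⟩ | ⟨w, r, i, hi, hib, hw, hr, rfl⟩
  · have h3 := hut (2 * j + 2)
    have h4 := hp.prefix h3 (by
      refine le_trans ?_ (length_le_subst _ _)
      simp; omega)
    exact not_semi_prefix_subst hj h4
  · obtain ⟨i, rfl⟩ := Nat.exists_eq_add_of_le' hi
    rw [List.replicate_succ, cons_append_stream, List.cons_append, isPre_cons] at hp
    exact absurd hp.1 (by decide)

/-! ### Products of squares of roots -/

theorem prodSquares_cons (X : Word) (Xs : List Word) :
    prodSquares (X :: Xs) = X ++ X ++ prodSquares Xs := by simp [prodSquares]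

theorem IsInfProdSquares.exists_tail {X : ℕ → Word} {s : InfWord} (h : IsInfProdSquares X s) :
    ∃ t, s = (X 0 ++ X 0) ++ₛ t ∧ IsInfProdSquares (fun n => X (n + 1)) t := by
  obtain ⟨t, ht⟩ := h.2 1
  have ht' : s = (X 0 ++ X 0) ++ₛ t := by simpa [prodSquares] using ht
  refine ⟨t, ht', fun i => h.1 (i + 1), fun n => ?_⟩
  obtain ⟨r, hr⟩ := h.2 (n + 1)
  refine ⟨r, ?_⟩
  rw [List.range_succ_eq_map, List.map_cons, prodSquares_cons, append_append_stream, ht'] at hr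
  have := Stream'.append_right_injective _ _ _ hr
  simpa [Function.comp_def] using this

theorem IsInfProdSquares.unique {b : ℕ → ℕ} (hb : ∀ k, 1 ≤ b k) {X Y : ℕ → Word} {s : InfWord}
    (hX : ∀ i, IsRoot b (X i)) (hXs : IsInfProdSquares X s)
    (hY : ∀ i, IsRoot b (Y i)) (hYs : IsInfProdSquares Y s) : X = Y := by
  funext n
  induction n generalizing X Y s with
  | zero =>
    obtain ⟨t, ht, -⟩ := hXs.exists_tail
    obtain ⟨r, hr, -⟩ := hYs.exists_tail
    exact (hX 0).eq_of_isPre hb (hY 0) ⟨t, ht⟩ ⟨r, hr⟩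
  | succ n ih =>
    obtain ⟨t, ht, hXt⟩ := hXs.exists_tail
    obtain ⟨r, hr, hYr⟩ := hYs.exists_tail
    have h0 := (hX 0).eq_of_isPre hb (hY 0) ⟨t, ht⟩ ⟨r, hr⟩
    rw [ht, h0] at hr
    rw [← Stream'.append_right_injective _ _ _ hr] at hYr
    exact ih (fun i => hX (i + 1)) hXt (fun i => hY (i + 1)) hYr

/-- Equal first squares are cancelled until the infinite product would have to start the exceptional
word c. -/
theorem IsInfProdSquares.ne_prodSquares_append {b : ℕ → ℕ} (hb : ∀ k, 1 ≤ b k) {X : ℕ → Word}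
    {s : InfWord} (hX : ∀ i, IsRoot b (X i)) (hXs : IsInfProdSquares X s) {Xs : List Word}
    (hXs' : ∀ Y ∈ Xs, IsRoot b Y) {c : InfWord}
    (hc : c = [0, 1] ++ₛ stdInf b ∨ c = [1, 0] ++ₛ stdInf b) : s ≠ prodSquares Xs ++ₛ c := by
  induction Xs generalizing X s with
  | nil =>
    rintro rfl
    obtain ⟨t, ht, -⟩ := hXs.exists_tail
    have hn := (hX 0).not_isPre hb
    rcases hc with rfl | rfl
    · exact hn.1 ⟨t, ht⟩
    · exact hn.2 ⟨t, ht⟩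
  | cons Y Xs ih =>
    intro hs
    obtain ⟨t, ht, hXt⟩ := hXs.exists_tail
    rw [prodSquares_cons, append_append_stream] at hs
    have h0 := (hX 0).eq_of_isPre hb (hXs' Y (by simp)) ⟨t, ht⟩ ⟨_, hs⟩
    rw [ht, h0] at hs
    exact ih (fun i => hX (i + 1)) hXt (fun Z hZ => hXs' Z (by simp [hZ]))
      (Stream'.append_right_injective _ _ _ hs)

/-- If every word with property `P` begins with the square of a word in `A` and the remaining
word has property `P`, then these words are infinite products of squares of words in `A`. -/
theorem exists_isInfProdSquares {A : Set Word} (hA : ∀ X ∈ A, X ≠ []) {P : InfWord → Prop}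
    (hP : ∀ s, P s → ∃ X ∈ A, ∃ t, s = (X ++ X) ++ₛ t ∧ P t) {s : InfWord} (hs : P s) :
    ∃ X : ℕ → Word, (∀ i, X i ∈ A) ∧ IsInfProdSquares X s := by
  choose! F hFA T hT hTP using hP
  have hPn : ∀ n, P (T^[n] s) := by
    intro n
    induction n with
    | zero => exact hs
    | succ n ih => rw [Function.iterate_succ_apply']; exact hTP _ ih
  refine ⟨fun n => F (T^[n] s), fun i => hFA _ (hPn i), fun i => hA _ (hFA _ (hPn i)),
    fun n => ⟨T^[n] s, ?_⟩⟩
  induction n with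
  | zero => rfl
  | succ n ih =>
    conv_lhs => rw [ih, hT _ (hPn n)]
    rw [List.range_succ, Function.iterate_succ_apply']
    simp [prodSquares]
/-! ### Comparison with the standard words of slope `α` -/

theorem wordPow_succ (w : Word) (n : ℕ) : wordPow w (n + 1) = w ++ wordPow w n := by
  simp [wordPow, List.replicate_succ]

theorem wordPow_singleton (x : Fin 2) (n : ℕ) : wordPow [x] n = replicate n x := by
  induction n with
  | zero => rfl
  | succ n ih => rw [wordPow_succ, ih, List.replicate_succ]; rfl

theorem cosubst_wordPow (b : ℕ) (w : Word) (n : ℕ) :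
    cosubst b (wordPow w n) = wordPow (cosubst b w) n := by
  induction n with
  | zero => rfl
  | succ n ih => rw [wordPow_succ, cosubst_append, ih, wordPow_succ]

theorem cosubst_replicate_zero (b n : ℕ) :
    cosubst b (replicate n 0) = wordPow (replicate b 0 ++ [1]) n := by
  rw [← wordPow_singleton, cosubst_wordPow]
  simp

theorem reverse_cosubst (b : ℕ) (w : Word) : (cosubst b w).reverse = subst b w.reverse := by
  induction w with
  | nil => rfl
  | cons x w ih =>
    rw [cosubst_cons, List.reverse_append, ih, List.reverse_cons, subst_append]
    obtain rfl | rfl := fin2_cases x <;> simp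

/-- The semistandard words for the sequence `b` of exponents. -/
def semistd (b : ℕ → ℕ) (k n : ℕ) : Word := wordPow (std b (k + 1)) n ++ std b k

theorem semistd_zero (b : ℕ → ℕ) (n : ℕ) :
    semistd b 0 n = cosubst (b 0) (replicate n 0 ++ [1]) := by
  simp [semistd, std, cosubst_replicate_zero]

theorem semistd_succ (b : ℕ → ℕ) (k n : ℕ) :
    semistd b (k + 1) n = cosubst (b 0) (semistd (shift b) k n) := by
  rw [semistd, semistd, cosubst_append, cosubst_wordPow]
  rfl

/-- This recovers the defining recursion of the standard words: it holds at the lowest level and is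
preserved by the substitution. -/
theorem std_add_two (b : ℕ → ℕ) (k : ℕ) : std b (k + 2) = semistd b k (b (k + 1)) := by
  induction k generalizing b with
  | zero => rw [semistd_zero]; simp [std]
  | succ k ih => rw [std_succ, ih, semistd_succ]

theorem isRoot_reverse_std (b : ℕ → ℕ) (k : ℕ) : IsRoot b (std b k).reverse := by
  induction k generalizing b with
  | zero => exact .zero b
  | succ k ih => rw [std_succ, reverse_cosubst]; exact .image b _ (ih _)

theorem isRoot_reverse_semistd (b : ℕ → ℕ) {k n : ℕ} (h1 : 1 ≤ n) (h2 : n < b (k + 1)) :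
    IsRoot b (semistd b k n).reverse := by
  induction k generalizing b with
  | zero =>
    rw [semistd_zero, reverse_cosubst]
    refine .image b _ ?_
    simpa using IsRoot.semi (shift b) n h1 h2
  | succ k ih => rw [semistd_succ, reverse_cosubst]; exact .image b _ (ih _ h2)

/-- The last alternative is the only one outside RSSt; one substitution moves it into the
semistandard family with k = 0. -/
theorem IsRoot.cases_reverse {b : ℕ → ℕ} {X : Word} (h : IsRoot b X) :
    (∃ k, X = (std b k).reverse) ∨
      (∃ k n, 1 ≤ n ∧ n < b (k + 1) ∧ X = (semistd b k n).reverse) ∨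
      ∃ n, 1 ≤ n ∧ n < b 0 ∧ X = 1 :: replicate n 0 := by
  induction h with
  | zero b => exact .inl ⟨0, rfl⟩
  | semi b n hn h => exact .inr (.inr ⟨n, hn, h, rfl⟩)
  | image b X h ih =>
    rcases ih with ⟨k, rfl⟩ | ⟨k, n, h1, h2, rfl⟩ | ⟨n, hn, h1, rfl⟩
    · exact .inl ⟨k + 1, by rw [std_succ, reverse_cosubst]⟩
    · exact .inr (.inl ⟨k + 1, n, h1, h2, by rw [semistd_succ, reverse_cosubst]⟩)
    · refine .inr (.inl ⟨0, n, hn, h1, ?_⟩)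
      rw [semistd_zero, reverse_cosubst]
      simp

/-- The exponents in the recursion of the standard words of slope `α`. -/
noncomputable def exponents (α : ℝ) : ℕ → ℕ
  | 0 => partialQuotient α 1 - 1
  | k + 1 => partialQuotient α (k + 2)

theorem standardWord_eq_std (α : ℝ) (k : ℕ) : standardWord α k = std (exponents α) k := by
  induction k using Nat.twoStepInduction with
  | zero => rfl
  | one => simp [standardWord, std, wordPow_singleton, exponents]
  | more k h1 h2 => rw [standardWord, std_add_two, semistd, h1, h2]; rfl

theorem semistandardWord_eq_semistd (α : ℝ) (k n : ℕ) :
    semistandardWord α k n = semistd (exponents α) k n := by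
  rw [semistandardWord, semistd, standardWord_eq_std, standardWord_eq_std]

theorem standardInfWord_eq_stdInf (α : ℝ) : standardInfWord α = stdInf (exponents α) := by
  funext n
  rw [standardInfWord, stdInf, standardWord_eq_std]

theorem isRoot_of_mem_RSSt {α : ℝ} {X : Word} (h : X ∈ RSSt α) : IsRoot (exponents α) X := by
  obtain ⟨w, ⟨k, rfl⟩ | ⟨k, n, h1, h2, rfl⟩, rfl⟩ := h
  · rw [standardWord_eq_std]; exact isRoot_reverse_std _ _
  · rw [semistandardWord_eq_semistd]; exact isRoot_reverse_semistd _ h1 h2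

theorem IsRoot.mem_RSSt_or {α : ℝ} {X : Word} (h : IsRoot (exponents α) X) :
    X ∈ RSSt α ∨ ∃ n < exponents α 0, X = 1 :: replicate n 0 := by
  rcases h.cases_reverse with ⟨k, rfl⟩ | ⟨k, n, h1, h2, rfl⟩ | ⟨n, -, h⟩
  · exact .inl ⟨_, .inl ⟨k, rfl⟩, by rw [standardWord_eq_std]⟩
  · exact .inl ⟨_, .inr ⟨k, n, h1, h2, rfl⟩, by rw [semistandardWord_eq_semistd]⟩
  · exact .inr ⟨n, h⟩

/-! ### Continued fractions and rotations -/

/-- The orbit of `α` under the Gauss map. -/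
noncomputable def gaussOrbit (α : ℝ) : ℕ → ℝ
  | 0 => α
  | k + 1 => Int.fract (gaussOrbit α k)⁻¹

theorem gaussOrbit_spec {α : ℝ} (hα : Irrational α) (h0 : 0 < α) (h1 : α < 1) (k : ℕ) :
    Irrational (gaussOrbit α k) ∧ 0 < gaussOrbit α k ∧ gaussOrbit α k < 1 := by
  induction k with
  | zero => exact ⟨hα, h0, h1⟩
  | succ k ih =>
    have hirr : Irrational (gaussOrbit α (k + 1)) := by
      rw [gaussOrbit, Int.fract]
      exact (irrational_inv_iff.2 ih.1).sub_intCast _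
    exact ⟨hirr, lt_of_le_of_ne (Int.fract_nonneg _) hirr.ne_zero.symm, Int.fract_lt_one _⟩

theorem stream_succ {α : ℝ} (hα : Irrational α) (h0 : 0 < α) (h1 : α < 1) (k : ℕ) :
    GenContFract.IntFractPair.stream α (k + 1) =
      some (GenContFract.IntFractPair.of (gaussOrbit α k)⁻¹) := by
  induction k with
  | zero =>
    have hf : Int.fract α = α := Int.fract_eq_self.2 ⟨h0.le, h1⟩
    simp [GenContFract.IntFractPair.stream, GenContFract.IntFractPair.of, hf, h0.ne', gaussOrbit]
  | succ k ih =>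
    have hne := (gaussOrbit_spec hα h0 h1 (k + 1)).2.1.ne'
    rw [gaussOrbit] at hne
    rw [GenContFract.IntFractPair.stream, ih]
    simp [GenContFract.IntFractPair.of, hne, gaussOrbit]

theorem partialQuotient_succ {α : ℝ} (hα : Irrational α) (h0 : 0 < α) (h1 : α < 1) (k : ℕ) :
    (partialQuotient α (k + 1) : ℝ) = (gaussOrbit α k)⁻¹ - gaussOrbit α (k + 1) := by
  have hp := (gaussOrbit_spec hα h0 h1 k).2.1
  have hnn : 0 ≤ ⌊(gaussOrbit α k)⁻¹⌋ := Int.floor_nonneg.2 (inv_nonneg.2 hp.le)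
  rw [partialQuotient, stream_succ hα h0 h1]
  simp only [GenContFract.IntFractPair.of, gaussOrbit, Int.fract, sub_sub_cancel]
  exact_mod_cast congrArg (Int.cast : ℤ → ℝ) (Int.toNat_of_nonneg hnn)

/-- The interval lengths in the renormalisation of the rotation by `α`. -/
noncomputable def lengths (α : ℝ) : ℕ → ℝ
  | 0 => 1 - α
  | k + 1 => ∏ i ∈ Finset.range (k + 1), gaussOrbit α i

theorem lengths_one (α : ℝ) : lengths α 1 = α := by simp [lengths, gaussOrbit]

theorem lengths_add_two (α : ℝ) (k : ℕ) :
    lengths α (k + 2) = lengths α (k + 1) * gaussOrbit α (k + 1) :=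
  Finset.prod_range_succ _ _

/-- The first relation is 1 - a₁α = (1 - α) - (a₁ - 1)α, which explains the exponent a₁ - 1; it is
positive because α < 1/2. The later relations are the Gauss map multiplied by a length. -/
theorem isChain_exponents {α : ℝ} (hα : Irrational α) (h0 : 0 < α) (h2 : α < 1 / 2) :
    IsChain (exponents α) (lengths α) := by
  have h1 : α < 1 := by linarith
  have hg := gaussOrbit_spec hα h0 h1
  have hq := partialQuotient_succ hα h0 h1
  have hpos : ∀ k, 0 < lengths α (k + 1) := fun k => Finset.prod_pos fun i _ => (hg i).2.1
  intro k
  cases k with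
  | zero =>
    have hq0 := hq 0
    have h3 : (2 : ℝ) < α⁻¹ := by
      rw [lt_inv_comm₀ two_pos h0]; simpa using h2
    have h4 : 2 ≤ partialQuotient α 1 := by
      have := (hg 1).2.2
      have h5 : (1 : ℝ) < partialQuotient α 1 := by
        rw [hq0]; simp only [gaussOrbit] at *; linarith
      exact_mod_cast h5
    refine ⟨by simp only [exponents]; omega, by simp only [lengths]; linarith, ?_, ?_⟩
    · rw [lengths_one, lengths]; linarith
    · rw [lengths_add_two, lengths_one, exponents, Nat.cast_sub (by omega), hq0, lengths]
      have : α * α⁻¹ = 1 := mul_inv_cancel₀ h0.ne'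
      simp only [gaussOrbit, zero_add] at *
      push_cast
      linear_combination this
  | succ k =>
    have hq1 := hq (k + 1)
    have hg1 := hg (k + 1)
    refine ⟨?_, hpos k, ?_, ?_⟩
    · have h3 : 1 < (gaussOrbit α (k + 1))⁻¹ := (one_lt_inv₀ hg1.2.1).2 hg1.2.2
      have h4 := (hg (k + 2)).2.2
      have h5 : (0 : ℝ) < partialQuotient α (k + 2) := by rw [hq1]; linarith
      exact_mod_cast h5
    · rw [lengths_add_two]
      exact mul_lt_of_lt_one_right (hpos k) hg1.2.2
    · rw [lengths_add_two, lengths_add_two, exponents, hq1]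
      have : gaussOrbit α (k + 1) * (gaussOrbit α (k + 1))⁻¹ = 1 := mul_inv_cancel₀ hg1.2.1.ne'
      linear_combination lengths α (k + 1) * this

/-- The codings of the orbits of a rotation, for a choice `F z` of the representative of `z` modulo
`1` that is compatible with the exchange of two intervals. -/
theorem coding_eq_of_step {e : Bool} {α : ℝ} {F : ℝ → ℝ}
    (hF : ∀ z, exchange e (1 - α) α (F z - (1 - α)) = F (z + α) - (1 - α)) (x : ℝ) (n : ℕ) :
    (exchange e (1 - α) α)^[n] (F x - (1 - α)) = F (x + n * α) - (1 - α) := by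
  induction n with
  | zero => simp
  | succ n ih =>
    rw [Function.iterate_succ_apply', ih, hF]
    push_cast
    ring_nf

theorem IsSturmian.isCoding {α : ℝ} (h0 : 0 < α) (h1 : α < 1) {s : InfWord}
    (hs : IsSturmian α s) : IsCoding (1 - α) α s := by
  classical
  obtain ⟨x, -, rfl | rfl⟩ := hs
  · have hF : ∀ z, exchange true (1 - α) α (Int.fract z - (1 - α)) =
        Int.fract (z + α) - (1 - α) := by
      intro z
      have hz0 := Int.fract_nonneg z
      have hz1 := Int.fract_lt_one z
      by_cases hp : IsPos true (Int.fract z - (1 - α))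
      · rw [exchange, if_pos hp]
        simp only [IsPos] at hp
        have : Int.fract (z + α) = Int.fract z + α - 1 := by
          rw [Int.fract_eq_iff]
          refine ⟨by linarith, by linarith, ⌊z⌋ + 1, ?_⟩
          have := Int.floor_add_fract z
          push_cast; linarith
        rw [this]; ring
      · rw [exchange, if_neg hp]
        simp only [IsPos] at hp
        have : Int.fract (z + α) = Int.fract z + α := by
          rw [Int.fract_eq_iff]
          refine ⟨by linarith, by linarith, ⌊z⌋, ?_⟩
          have := Int.floor_add_fract z
          linarith
        rw [this]; ring
    refine ⟨true, Int.fract x - (1 - α), ?_, ?_⟩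
    · simp only [InDomain, IsPos]
      have := Int.fract_nonneg x
      have := Int.fract_lt_one x
      exact ⟨by linarith, by linarith⟩
    · funext n
      rw [coding, coding_eq_of_step hF, lowerCoding]
      have := Int.fract_nonneg (x + n * α)
      simp only [Set.mem_Ico, IsPos, this, true_and, sub_nonneg]
      split_ifs <;> first | rfl | (exfalso; linarith)
  -- The representative of z modulo 1 is now taken in (0, 1], matching the other endpoint
  -- convention.
  · have hF : ∀ z, exchange false (1 - α) α (z - ⌈z⌉ + 1 - (1 - α)) =
        (z + α) - ⌈z + α⌉ + 1 - (1 - α) := by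
      intro z
      have hz0 := Int.le_ceil z
      have hz1 := Int.ceil_lt_add_one z
      by_cases hp : IsPos false (z - ⌈z⌉ + 1 - (1 - α))
      · rw [exchange, if_pos hp]
        simp only [IsPos] at hp
        have : ⌈z + α⌉ = ⌈z⌉ + 1 := by
          rw [Int.ceil_eq_iff]
          push_cast
          exact ⟨by linarith, by linarith⟩
        rw [this]; push_cast; ring
      · rw [exchange, if_neg hp]
        simp only [IsPos] at hp
        have : ⌈z + α⌉ = ⌈z⌉ := by
          rw [Int.ceil_eq_iff]
          exact ⟨by linarith, by linarith⟩
        rw [this]; ring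
    refine ⟨false, x - ⌈x⌉ + 1 - (1 - α), ?_, ?_⟩
    · simp only [InDomain, IsPos]
      have := Int.le_ceil x
      have := Int.ceil_lt_add_one x
      exact ⟨by linarith, by linarith⟩
    · funext n
      rw [coding, coding_eq_of_step (F := fun z => z - ⌈z⌉ + 1) hF, upperCoding]
      set z := x + n * α
      simp only [IsPos]
      have hz := Int.fract_nonneg z
      have hfl := Int.floor_add_fract z
      -- Here the representative is 1 while the fractional part is 0; both conventions read the
      -- letter 1.
      by_cases hz0 : Int.fract z = 0
      · have : ⌈z⌉ = ⌊z⌋ := by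
          rw [Int.ceil_eq_iff]; exact ⟨by linarith, by linarith⟩
        rw [if_neg (by rw [hz0]; simp)]
        exact (if_pos (by rw [this]; linarith)).symm
      · have hz' : 0 < Int.fract z := lt_of_le_of_ne hz (Ne.symm hz0)
        have h2 := Int.fract_lt_one z
        have : ⌈z⌉ = ⌊z⌋ + 1 := by
          rw [Int.ceil_eq_iff]; push_cast; exact ⟨by linarith, by linarith⟩
        have h3 : z - ⌈z⌉ + 1 = Int.fract z := by rw [this]; push_cast; linarith
        rw [h3]
        simp only [Set.mem_Ioc, hz', true_and, sub_pos]
        split_ifs <;> first | rfl | (exfalso; linarith)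

end SturmianSquares

open SturmianSquares in
theorem mainTheorem5 (α : ℝ) (hα : Irrational α) (hα0 : 0 < α) (hα2 : α < 1 / 2)
    (s : Stream' (Fin 2)) (hs : SturmianSquares.IsSturmian α s) :
    ((∃ X : ℕ → List (Fin 2), (∀ i, X i ∈ SturmianSquares.RSSt α) ∧
        SturmianSquares.IsInfProdSquares X s) ↔
      ¬ ∃ (Xs : List (List (Fin 2))) (c : Stream' (Fin 2)),
        (∀ X ∈ Xs, X ∈ SturmianSquares.RSSt α) ∧
        (c = [0, 1] ++ₛ SturmianSquares.standardInfWord α ∨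
          c = [1, 0] ++ₛ SturmianSquares.standardInfWord α) ∧
        s = SturmianSquares.prodSquares Xs ++ₛ c) ∧
    (∀ X Y : ℕ → List (Fin 2),
      (∀ i, X i ∈ SturmianSquares.RSSt α) → SturmianSquares.IsInfProdSquares X s →
      (∀ i, Y i ∈ SturmianSquares.RSSt α) → SturmianSquares.IsInfProdSquares Y s →
      X = Y) := by
  have hchain := isChain_exponents hα hα0 hα2
  have hb : ∀ k, 1 ≤ exponents α k := fun k => (hchain k).1
  have hcod : IsCoding (lengths α 0) (lengths α 1) s := by
    rw [lengths_one]; exact hs.isCoding hα0 (by linarith)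
  refine ⟨⟨?_, fun hne => ?_⟩, fun X Y hX hXs hY hYs => ?_⟩
  · rintro ⟨X, hX, hXs⟩ ⟨Xs, c, hXs', hc, h⟩
    rw [standardInfWord_eq_stdInf] at hc
    exact hXs.ne_prodSquares_append hb (fun i => isRoot_of_mem_RSSt (hX i))
      (fun Y hY => isRoot_of_mem_RSSt (hXs' Y hY)) hc h
  -- The invariant pairs being a coding with not having the exceptional form; the latter passes to
  -- the remainder, since prepending a square would restore that form.
  · refine exists_isInfProdSquares (A := RSSt α)
      (P := fun s => IsCoding (lengths α 0) (lengths α 1) s ∧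
        ¬ ∃ (Xs : List Word) (c : InfWord), (∀ X ∈ Xs, X ∈ RSSt α) ∧
          (c = [0, 1] ++ₛ standardInfWord α ∨ c = [1, 0] ++ₛ standardInfWord α) ∧
          s = prodSquares Xs ++ₛ c)
      (fun X hX => (isRoot_of_mem_RSSt hX).ne_nil hb) ?_ ⟨hcod, hne⟩
    rintro s ⟨hs, hne⟩
    rcases hs.exists_root hchain with ⟨X, hX, t, ht⟩ | hc
    · rcases hX.mem_RSSt_or with hX' | ⟨n, hn, rfl⟩
      · refine ⟨X, hX', t, ht, ?_, ?_⟩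
        · rw [ht] at hs
          exact hs.of_append (hchain 0).2.1 (hchain 1).2.1
        · rintro ⟨Xs, c, hXs, hc, rfl⟩
          refine hne ⟨X :: Xs, c, ?_, hc, ?_⟩
          · simpa [hX'] using hXs
          · rw [ht, prodSquares_cons, Stream'.append_append_stream (X ++ X)]
      · exact absurd ⟨t, ht⟩ (hs.not_isPre_semi hchain hn)
    · rw [← standardInfWord_eq_stdInf] at hc
      exact absurd ⟨[], s, by simp, hc, rfl⟩ hne
  · exact IsInfProdSquares.unique hb (fun i => isRoot_of_mem_RSSt (hX i)) hXs
      (fun i => isRoot_of_mem_RSSt (hY i)) hYs
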